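/- Let $n\ge 1$ be an integer and let $r=(r_1,\dots,r_n)$ be a tuple of positive integers with $r_i\mid r_{i+1}$ for $1\le i\le n-1$. Put $\delta_r=\operatorname{diag}(r_1,\dots,r_n,1,\dots,1)\in GL(2n;\mathbb R)$ and $J=\begin{pmatrix}0&\mathrm{Id}_n\\-\mathrm{Id}_n&0\end{pmatrix}$. Let $G_r=\delta_r\,GL(2n;\mathbb Z)\,\delta_r^{-1}$, let $\widetilde{Sp}(2n;\mathbb R)=\{\beta\in GL(2n;\mathbb R)\mid \beta^tJ\beta=\pm J\}$, and let $\Pi_r=G_r\cap\widetilde{Sp}(2n;\mathbb R)$. Let $\mathcal P_{2n}$ be the space of real symmetric positive definite $2n\times 2n$ matrices. The group $\Pi_r$ acts from the right on $\mathcal P_{2n}\times(0,\infty)$ by $(h,g)\cdot\beta=(\beta^th\beta,g)$; let $\mathcal M_n^r=(\mathcal P_{2n}\times(0,\infty))/\Pi_r$ with the quotient topology. For $h\in\mathcal P_{2n}$ set $$m_r(h)=\inf\{(\delta_ra)^t\,h\,(\delta_ra)\mid a\in\mathbb Z^{2n}\setminus\{0\}\},$$ and let $d_n(h)$ be the largest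 of the numbers $0<d_1(h)\le\dots\le d_n(h)$ for which $\pm i\,d_1(h),\dots,\pm i\,d_n(h)$ are the eigenvalues of $h^{-1}J$. Let $M\subset\mathcal M_n^r$. Assume that there are constants $C_0,C_1,C_2>0$ and a compact interval $I\subset(0,\infty)$ such that $g\in I$, $m_r(h)\ge C_0$, $\det h\le C_1$ and $d_n(h)\le C_2$ for all $[(h,g)]\in M$. Then $M$ has compact closure in $\mathcal M_n^r$. -/

import Mathlib

open scoped Matrix

namespace Heisenberg

/-- Index type of the standard basis `X₁, …, Xₙ, Y₁, …, Yₙ` of `ℝ²ⁿ`. -/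
abbrev Idx (n : ℕ) : Type := Fin n ⊕ Fin n

/-- The matrix `J = [[0, Id], [-Id, 0]]` of the standard symplectic form on `ℝ²ⁿ`. -/
def symplJ (n : ℕ) : Matrix (Idx n) (Idx n) ℝ :=
  Matrix.fromBlocks 0 1 (-1) 0

/-- `𝒫₂ₙ`: real symmetric positive definite `2n × 2n` matrices, with the subspace topology. -/
abbrev PosMat (n : ℕ) : Type :=
  {Y : Matrix (Idx n) (Idx n) ℝ // Y.PosDef}

/-- `𝒟ₙ`: tuples of positive integers `(r₁, …, rₙ)` with `rᵢ ∣ rᵢ₊₁`. -/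
structure DivChain (n : ℕ) where
  toFun : Fin n → ℕ
  pos : ∀ i, 0 < toFun i
  dvd_succ : ∀ (i : ℕ) (hi : i + 1 < n), toFun ⟨i, Nat.lt_of_succ_lt hi⟩ ∣ toFun ⟨i + 1, hi⟩

/-- `δ_r = diag(r₁, …, rₙ, 1, …, 1)`. -/
def deltaMat {n : ℕ} (r : DivChain n) : Matrix (Idx n) (Idx n) ℝ :=
  Matrix.diagonal (Sum.elim (fun i => (r.toFun i : ℝ)) (fun _ => 1))

theorem deltaMat_det_ne_zero {n : ℕ} (r : DivChain n) : (deltaMat r).det ≠ 0 := by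
  rw [deltaMat, Matrix.det_diagonal]
  refine Finset.prod_ne_zero_iff.2 ?_
  rintro (i | i) -
  · simpa using (r.pos i).ne'
  · simp

/-- `δ_r` as an element of `GL(2n; ℝ)`. -/
noncomputable def delta {n : ℕ} (r : DivChain n) : GL (Idx n) ℝ :=
  Matrix.GeneralLinearGroup.mkOfDetNeZero (deltaMat r) (deltaMat_det_ne_zero r)

/-- `GL(2n; ℤ)` as a subgroup of `GL(2n; ℝ)`. -/
noncomputable def intGL (n : ℕ) : Subgroup (GL (Idx n) ℝ) :=
  (Matrix.GeneralLinearGroup.map (n := Idx n) (Int.castRingHom ℝ)).range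

/-- `G_r = δ_r GL(2n; ℤ) δ_r⁻¹`. -/
noncomputable def latticeGroup {n : ℕ} (r : DivChain n) : Subgroup (GL (Idx n) ℝ) :=
  (intGL n).map (MulAut.conj (delta r)).toMonoidHom

/-- The group of all `β ∈ GL(2n; ℝ)` with `βᵀ J β = ± J`. -/
def extSp (n : ℕ) : Subgroup (GL (Idx n) ℝ) where
  carrier := {β |
    (β : Matrix (Idx n) (Idx n) ℝ)ᵀ * symplJ n * (β : Matrix (Idx n) (Idx n) ℝ) = symplJ n ∨
    (β : Matrix (Idx n) (Idx n) ℝ)ᵀ * symplJ n * (β : Matrix (Idx n) (Idx n) ℝ) = -symplJ n}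
  one_mem' := by left; simp
  mul_mem' := by
    intro a b ha hb
    have key : ((a * b : GL (Idx n) ℝ) : Matrix (Idx n) (Idx n) ℝ)ᵀ * symplJ n *
        ((a * b : GL (Idx n) ℝ) : Matrix (Idx n) (Idx n) ℝ) =
        (b : Matrix (Idx n) (Idx n) ℝ)ᵀ * ((a : Matrix (Idx n) (Idx n) ℝ)ᵀ * symplJ n *
          (a : Matrix (Idx n) (Idx n) ℝ)) * (b : Matrix (Idx n) (Idx n) ℝ) := by
      simp [Matrix.transpose_mul, Matrix.mul_assoc]
    simp only [Set.mem_ofPred_eq] at ha hb ⊢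
    rw [key]
    rcases ha with ha | ha <;> rcases hb with hb | hb <;> rw [ha] <;> simp [hb]
  inv_mem' := by
    intro a ha
    simp only [Set.mem_ofPred_eq] at ha ⊢
    have h1 : (a : Matrix (Idx n) (Idx n) ℝ) *
        ((a⁻¹ : GL (Idx n) ℝ) : Matrix (Idx n) (Idx n) ℝ) = 1 := by
      rw [← Units.val_mul, mul_inv_cancel, Units.val_one]
    have h2 : ((a⁻¹ : GL (Idx n) ℝ) : Matrix (Idx n) (Idx n) ℝ)ᵀ *
        (a : Matrix (Idx n) (Idx n) ℝ)ᵀ = 1 := by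
      rw [← Matrix.transpose_mul, h1, Matrix.transpose_one]
    have key : ((a⁻¹ : GL (Idx n) ℝ) : Matrix (Idx n) (Idx n) ℝ)ᵀ *
        ((a : Matrix (Idx n) (Idx n) ℝ)ᵀ * symplJ n * (a : Matrix (Idx n) (Idx n) ℝ)) *
        ((a⁻¹ : GL (Idx n) ℝ) : Matrix (Idx n) (Idx n) ℝ) = symplJ n := by
      rw [Matrix.mul_assoc, Matrix.mul_assoc, h1, Matrix.mul_one, ← Matrix.mul_assoc, h2,
        Matrix.one_mul]
    rcases ha with ha | ha
    · left; rw [ha] at key; exact key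
    · right
      rw [ha, Matrix.mul_neg, Matrix.neg_mul] at key
      rw [← key, neg_neg, key]

/-- `Π_r`: the intersection of `G_r` with the extended symplectic group. -/
noncomputable def piGroup {n : ℕ} (r : DivChain n) : Subgroup (GL (Idx n) ℝ) :=
  latticeGroup r ⊓ extSp n

/-- The orbit equivalence relation of the right action `(h, g) ↦ (βᵀ h β, g)` of `Π_r` on
`𝒫₂ₙ × (0, ∞)`. (On the `g`-coordinate `β` acts by `ε(β)² = 1`.) -/
def moduliSetoid {n : ℕ} (r : DivChain n) : Setoid (PosMat n × Set.Ioi (0 : ℝ)) where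
  r p q := ∃ β ∈ piGroup r,
    (q.1 : Matrix (Idx n) (Idx n) ℝ) = (β : Matrix (Idx n) (Idx n) ℝ)ᵀ * p.1 * β ∧ q.2 = p.2
  iseqv :=
    { refl := fun p => ⟨1, one_mem _, by simp, rfl⟩
      symm := by
        rintro p q ⟨β, hβ, h1, h2⟩
        refine ⟨β⁻¹, inv_mem hβ, ?_, h2.symm⟩
        have e1 : (β : Matrix (Idx n) (Idx n) ℝ) *
            ((β⁻¹ : GL (Idx n) ℝ) : Matrix (Idx n) (Idx n) ℝ) = 1 := by
          rw [← Units.val_mul, mul_inv_cancel, Units.val_one]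
        have e2 : ((β⁻¹ : GL (Idx n) ℝ) : Matrix (Idx n) (Idx n) ℝ)ᵀ *
            (β : Matrix (Idx n) (Idx n) ℝ)ᵀ = 1 := by
          rw [← Matrix.transpose_mul, e1, Matrix.transpose_one]
        rw [h1, Matrix.mul_assoc, Matrix.mul_assoc, e1, Matrix.mul_one, ← Matrix.mul_assoc, e2,
          Matrix.one_mul]
      trans := by
        rintro p q s ⟨β, hβ, h1, h2⟩ ⟨γ, hγ, h3, h4⟩
        refine ⟨β * γ, mul_mem hβ hγ, ?_, h4.trans h2⟩
        rw [h3, h1]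
        simp [Matrix.transpose_mul, Matrix.mul_assoc] }

/-- The moduli space `𝓜ₙʳ = (𝒫₂ₙ × (0, ∞)) / Π_r`, with the quotient topology. -/
abbrev Moduli {n : ℕ} (r : DivChain n) : Type :=
  Quotient (moduliSetoid r)

/-- The class `[(h, g)] ∈ 𝓜ₙʳ`. -/
def Moduli.mk {n : ℕ} (r : DivChain n) (h : PosMat n) (g : Set.Ioi (0 : ℝ)) : Moduli r :=
  Quotient.mk (moduliSetoid r) (h, g)

/-- `m_r(Y) = inf {Y[δ_r a] | a ∈ ℤ²ⁿ ∖ {0}}`, where `Y[v] = vᵀ Y v`. -/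
noncomputable def firstMin {n : ℕ} (r : DivChain n) (Y : PosMat n) : ℝ :=
  sInf {t : ℝ | ∃ a : Idx n → ℤ, a ≠ 0 ∧
    t = (deltaMat r *ᵥ fun i => (a i : ℝ)) ⬝ᵥ
      ((Y : Matrix (Idx n) (Idx n) ℝ) *ᵥ (deltaMat r *ᵥ fun i => (a i : ℝ)))}

/-- The set of all `d > 0` such that `i d` is an eigenvalue (over `ℂ`) of `Y⁻¹ J`. As the
eigenvalues of the real matrix `Y⁻¹ J` are nonzero, purely imaginary and closed under conjugation,
this is `{d₁(Y), …, dₙ(Y)}`, where `± i d₁(Y), …, ± i dₙ(Y)` are the eigenvalues of `Y⁻¹ J`. -/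
def dSet {n : ℕ} (Y : PosMat n) : Set ℝ :=
  {d : ℝ | 0 < d ∧ Module.End.HasEigenvalue
    (Matrix.toLin' (((Y : Matrix (Idx n) (Idx n) ℝ)⁻¹ * symplJ n).map ((↑) : ℝ → ℂ)))
    (Complex.I * (d : ℂ))}

/-- `dₙ(Y)`: the largest of the numbers `d₁(Y) ≤ … ≤ dₙ(Y)`. -/
noncomputable def dMax {n : ℕ} (Y : PosMat n) : ℝ :=
  sSup (dSet Y)

end Heisenberg

/-! The form `δᵀhδ` has integral minimum at least `C₀` and bounded determinant, so by Mahler's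
criterion (`exists_compact_of_minimum_of_det`) some `γ ∈ GL(2n; ℤ)` brings it into a fixed compact
set `K`. In general `δγδ⁻¹` is not symplectic.

Put `G = δγ`. The matrix `GᵀJG` is integral, and the bound on `dₙ(h)` says that `J` is dominated by
`C₂ h` (`two_mul_dotProduct_le_of_eigenvalue_le`), so its entries are bounded through the diagonal
of `GᵀhG ∈ K`. Only finitely many matrices `B = GᵀJG` occur. Fixing for each one an integral `η B`
with `(δη)ᵀJ(δη) = B`, the element `β = δγη⁻¹δ⁻¹` lies in `Π_r` and moves `h` into one of finitely
many transforms of `K` (`exists_compact_fundamental`).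

To pass to the closure, the bounds are replaced by the closed, `Π_r`-invariant condition
`Controlled`. Its saturated locus has closed image in the quotient, and that image is covered by a
compact set; no separation property of the quotient is needed. -/

namespace Heisenberg

/-! ### Reduction of positive definite forms and Mahler's criterion -/

section Reduction

variable {ι κ : Type*} [Fintype ι]

/-- The real matrix with the given integer entries. -/
abbrev realMat (γ : Matrix ι κ ℤ) : Matrix ι κ ℝ := γ.map (Int.cast : ℤ → ℝ)

theorem realMat_mul (γ η : Matrix ι ι ℤ) : realMat (γ * η) = realMat γ * realMat η :=
  Matrix.map_mul (f := Int.castRingHom ℝ)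

theorem congr_apply_self (q : Matrix ι ι ℝ) (g : Matrix ι κ ℝ) (j : κ) :
    (gᵀ * q * g) j j = (fun i => g i j) ⬝ᵥ (q *ᵥ fun i => g i j) := by
  rw [Matrix.mul_assoc, Matrix.mul_apply_eq_vecMul]
  simp [Matrix.mul_apply, dotProduct, Matrix.mulVec, Matrix.transpose_apply, Matrix.vecMul]

/-- A positive definite form is bounded below on the nonzero integer vectors. -/
theorem exists_pos_le_of_posDef {q : Matrix ι ι ℝ} (hq : q.PosDef) :
    ∃ ε > 0, ∀ a : ι → ℤ, a ≠ 0 → ε ≤ (fun i => (a i : ℝ)) ⬝ᵥ (q *ᵥ fun i => (a i : ℝ)) := by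
  classical
  rcases isEmpty_or_nonempty ι with hι | hι
  · exact ⟨1, one_pos, fun a ha => (ha (Subsingleton.elim _ _)).elim⟩
  have hcont : Continuous fun x : ι → ℝ => x ⬝ᵥ (q *ᵥ x) := by fun_prop
  obtain ⟨x, hx, hmin⟩ := (isCompact_sphere (0 : ι → ℝ) 1).exists_isMinOn
    (NormedSpace.sphere_nonempty.2 zero_le_one) hcont.continuousOn
  have hx0 : x ≠ 0 := by
    rintro rfl
    simp at hx
  refine ⟨_, hq.dotProduct_mulVec_pos hx0, fun a ha => ?_⟩
  set y : ι → ℝ := fun i => (a i : ℝ) with hy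
  have hy1 : 1 ≤ ‖y‖ := by
    obtain ⟨i, hi⟩ := Function.ne_iff.1 ha
    refine le_trans ?_ (norm_le_pi_norm y i)
    rw [hy, Real.norm_eq_abs, ← Int.cast_abs]
    exact_mod_cast Int.one_le_abs hi
  have hy0 : ‖y‖ ≠ 0 := by positivity
  have hsph : ‖y‖⁻¹ • y ∈ Metric.sphere (0 : ι → ℝ) 1 := by
    simp [norm_smul, hy0]
  have h1 : x ⬝ᵥ (q *ᵥ x) ≤ (‖y‖⁻¹ • y) ⬝ᵥ (q *ᵥ (‖y‖⁻¹ • y)) := hmin hsph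
  have hpos : 0 ≤ y ⬝ᵥ (q *ᵥ y) := by simpa using hq.posSemidef.dotProduct_mulVec_nonneg y
  simp only [Matrix.mulVec_smul, smul_dotProduct, dotProduct_smul, smul_eq_mul] at h1
  have hinv : ‖y‖⁻¹ ≤ 1 := inv_le_one_of_one_le₀ hy1
  have hinv0 : 0 ≤ ‖y‖⁻¹ := by positivity
  have h2 : ‖y‖⁻¹ * (‖y‖⁻¹ * (y ⬝ᵥ (q *ᵥ y))) ≤ y ⬝ᵥ (q *ᵥ y) := by
    have h3 := mul_le_of_le_one_left hpos hinv
    exact (mul_le_mul_of_nonneg_left h3 hinv0).trans h3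
  simpa using h1.trans h2

variable [DecidableEq ι] [Fintype κ] [DecidableEq κ]

theorem det_realMat (γ : Matrix ι ι ℤ) : (realMat γ).det = (γ.det : ℝ) :=
  ((Int.castRingHom ℝ).map_det γ).symm

theorem isUnit_det_realMat {γ : Matrix ι ι ℤ} (hγ : IsUnit γ.det) : IsUnit (realMat γ).det := by
  rw [det_realMat]
  exact hγ.map (Int.castRingHom ℝ)

theorem posDef_congr {q g : Matrix ι ι ℝ} (hq : q.PosDef) (hg : IsUnit g.det) :
    (gᵀ * q * g).PosDef := by
  have h := hq.conjTranspose_mul_mul_same (B := g)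
    (Matrix.mulVec_injective_iff_isUnit.2 ((Matrix.isUnit_iff_isUnit_det _).2 hg))
  rwa [Matrix.conjTranspose_eq_transpose_of_trivial] at h

theorem column_ne_zero {γ : Matrix ι ι ℤ} (hγ : IsUnit γ.det) (j : ι) :
    (fun i => γ i j) ≠ 0 := by
  intro h
  have : γ.det = 0 := Matrix.det_eq_zero_of_column_eq_zero j fun i => congrFun h i
  simp [this] at hγ

/-- Up to a factor two, the smallest diagonal entry of a form among all its integral bases is
attained in a prescribed position. -/
theorem exists_unimodular_almost_minimal {q : Matrix ι ι ℝ} (hq : q.PosDef) (u : ι) :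
    ∃ γ : Matrix ι ι ℤ, IsUnit γ.det ∧ ∀ η : Matrix ι ι ℤ, IsUnit η.det → ∀ j,
      ((realMat γ)ᵀ * q * realMat γ) u u < 2 * ((realMat η)ᵀ * q * realMat η) j j := by
  obtain ⟨ε, hε, hle⟩ := exists_pos_le_of_posDef hq
  set V : Set ℝ := {x | ∃ γ : Matrix ι ι ℤ, IsUnit γ.det ∧ ∃ j,
    x = ((realMat γ)ᵀ * q * realMat γ) j j} with hV
  have hlow : ∀ x ∈ V, ε ≤ x := by
    rintro x ⟨γ, hγ, j, rfl⟩
    rw [congr_apply_self]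
    exact hle _ (column_ne_zero hγ j)
  have hne : V.Nonempty := ⟨_, 1, by simp, u, rfl⟩
  have hinf : ε ≤ sInf V := le_csInf hne hlow
  have hbdd : BddBelow V := ⟨ε, hlow⟩
  -- The infimum is positive, hence strictly below its double; the factor two avoids proving that it
  -- is attained.
  obtain ⟨x, ⟨γ, hγ, j, rfl⟩, hx⟩ := exists_lt_of_csInf_lt hne
    (show sInf V < 2 * sInf V by linarith)
  refine ⟨γ.submatrix id (Equiv.swap j u), ?_, fun η hη i => ?_⟩
  · rw [Matrix.det_permute']
    exact (Units.isUnit _).mul hγ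
  · have h1 : sInf V ≤ ((realMat η)ᵀ * q * realMat η) i i := csInf_le hbdd ⟨η, hη, i, rfl⟩
    have h2 : ((realMat (γ.submatrix id (Equiv.swap j u)))ᵀ * q *
        realMat (γ.submatrix id (Equiv.swap j u))) u u = ((realMat γ)ᵀ * q * realMat γ) j j := by
      simp [congr_apply_self]
    rw [h2]
    linarith

/-- A form is reduced if it is `Tᵀ D T` with `T` of determinant one and bounded entries, and `D`
diagonal and positive, with no entry of `D` much smaller than all diagonal entries of the form. -/
def SiegelReduced (Q : Matrix ι ι ℝ) : Prop :=
  ∃ (T : Matrix ι ι ℝ) (d : ι → ℝ), T.det = 1 ∧ (∀ i j, |T i j| ≤ 1) ∧ (∀ i, 0 < d i) ∧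
    Q = Tᵀ * Matrix.diagonal d * T ∧ ∀ j, ∃ i, Q i i ≤ 4 ^ Fintype.card ι * d j

theorem SiegelReduced.submatrix {Q : Matrix ι ι ℝ} (hQ : SiegelReduced Q) (e : κ ≃ ι) :
    SiegelReduced (Q.submatrix e e) := by
  obtain ⟨T, d, hT, hT1, hd, rfl, hj⟩ := hQ
  refine ⟨T.submatrix e e, d ∘ e, by simpa using hT, fun i j => hT1 _ _, fun i => hd _, ?_,
    fun j => ?_⟩
  · rw [Matrix.transpose_submatrix, ← Matrix.submatrix_diagonal_equiv, Matrix.submatrix_mul_equiv,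
      Matrix.submatrix_mul_equiv]
  · obtain ⟨i, hi⟩ := hj (e j)
    exact ⟨e.symm i, by simpa [Fintype.card_congr e] using hi⟩

/-- Positive definite forms in these variables can be reduced by an integral change of basis. -/
def Reducible (ι : Type*) [Fintype ι] [DecidableEq ι] : Prop :=
  ∀ q : Matrix ι ι ℝ, q.PosDef →
    ∃ γ : Matrix ι ι ℤ, IsUnit γ.det ∧ SiegelReduced ((realMat γ)ᵀ * q * realMat γ)

theorem Reducible.of_equiv (h : Reducible ι) (e : ι ≃ κ) : Reducible κ := by
  intro q hq
  obtain ⟨γ, hγ, hred⟩ := h (q.submatrix e e) (hq.submatrix e.injective)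
  refine ⟨γ.submatrix e.symm e.symm, by simpa using hγ, ?_⟩
  convert hred.submatrix e.symm using 1
  rw [← Matrix.submatrix_mul_equiv _ _ _ e.symm, ← Matrix.submatrix_mul_equiv _ _ _ e.symm]
  congr 2
  simp

theorem reducible_of_isEmpty [IsEmpty ι] : Reducible ι := fun q _ =>
  ⟨1, by simp, 1, 1, by simp, fun i => isEmptyElim i, fun i => isEmptyElim i,
    Subsingleton.elim _ _, fun i => isEmptyElim i⟩

theorem abs_add_neg_round_le (x : ℝ) : |((-round x : ℤ) : ℝ) + x| ≤ 1 / 2 := by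
  have := abs_sub_round x
  rwa [Int.cast_neg, neg_add_eq_sub]

/-- Completing the square in the first variable. -/
theorem exists_schur {q : Matrix (Unit ⊕ ι) (Unit ⊕ ι) ℝ} (hq : q.PosDef) :
    ∃ (d : ℝ) (t : Matrix Unit ι ℝ) (S : Matrix ι ι ℝ), 0 < d ∧ S.PosDef ∧
      q = (Matrix.fromBlocks 1 t 0 1)ᵀ * Matrix.fromBlocks (Matrix.diagonal fun _ => d) 0 0 S *
        Matrix.fromBlocks 1 t 0 1 := by
  set d := q (Sum.inl ()) (Sum.inl ()) with hd
  have hd0 : 0 < d := hq.diag_pos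
  set t : Matrix Unit ι ℝ := d⁻¹ • q.toBlocks₁₂ with ht
  set S := q.toBlocks₂₂ - d • (tᵀ * t) with hS
  have hsymm : qᵀ = q := by
    have := hq.isHermitian.eq
    rwa [Matrix.conjTranspose_eq_transpose_of_trivial] at this
  have hdt : d • t = q.toBlocks₁₂ := by
    rw [ht, smul_smul, mul_inv_cancel₀ hd0.ne', one_smul]
  have h21 : q.toBlocks₂₁ = (q.toBlocks₁₂)ᵀ := by
    ext i j
    exact congrFun (congrFun hsymm.symm (Sum.inr i)) (Sum.inl j)
  have h11 : q.toBlocks₁₁ = Matrix.diagonal fun _ => d := by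
    ext i j
    simp [Matrix.toBlocks₁₁, hd]
  have key : q = (Matrix.fromBlocks 1 t 0 1)ᵀ *
      Matrix.fromBlocks (Matrix.diagonal fun _ => d) 0 0 S * Matrix.fromBlocks 1 t 0 1 := by
    have hdiag : (Matrix.diagonal fun _ : Unit => d) = d • (1 : Matrix Unit Unit ℝ) := by
      rw [Matrix.smul_one_eq_diagonal]
    conv_lhs => rw [← Matrix.fromBlocks_toBlocks q, h21, h11, ← hdt]
    simp [Matrix.fromBlocks_transpose, Matrix.fromBlocks_multiply, hdiag, hS]
  refine ⟨d, t, S, hd0, ?_, key⟩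
  set L : Matrix (Unit ⊕ ι) (Unit ⊕ ι) ℝ := Matrix.fromBlocks 1 t 0 1 with hL
  have hLdet : IsUnit L.det := by simp [hL]
  have h1 : (L⁻¹ᵀ * q * L⁻¹).PosDef := posDef_congr hq (by simpa using hLdet)
  have h2 : L⁻¹ᵀ * q * L⁻¹ = Matrix.fromBlocks (Matrix.diagonal fun _ => d) 0 0 S := by
    have e1 : L * L⁻¹ = 1 := Matrix.mul_nonsing_inv _ hLdet
    have e2 : L⁻¹ᵀ * Lᵀ = 1 := by rw [← Matrix.transpose_mul, e1, Matrix.transpose_one]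
    rw [key, Matrix.mul_assoc, Matrix.mul_assoc, Matrix.mul_assoc, e1, Matrix.mul_one,
      ← Matrix.mul_assoc, e2, Matrix.one_mul]
  rw [h2] at h1
  exact h1.submatrix (e := Sum.inr) Sum.inr_injective

/-- Induction step of Hermite reduction: choose an almost minimal first basis vector, split it off
by completing the square, reduce the Schur complement, and size-reduce the first row by rounding.
Minimizing over whole bases avoids extending a primitive vector to a basis. -/
theorem Reducible.unit_sum (h : Reducible ι) : Reducible (Unit ⊕ ι) := by
  intro q hq
  obtain ⟨γ₁, hγ₁, hmin⟩ := exists_unimodular_almost_minimal hq (Sum.inl ())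
  obtain ⟨d, t, S, hd, hS, hq₁⟩ := exists_schur (posDef_congr hq (isUnit_det_realMat hγ₁))
  obtain ⟨η, hη, T, e, hT, hT1, he, hST, hle⟩ := h S hS
  set s : Matrix Unit ι ℤ := Matrix.of fun i j => -round ((t * realMat η) i j) with hs
  set w : Matrix Unit ι ℝ := realMat s + t * realMat η with hw
  have hw1 : ∀ i j, |w i j| ≤ 1 / 2 := fun i j => abs_add_neg_round_le _
  set γ₂ : Matrix (Unit ⊕ ι) (Unit ⊕ ι) ℤ := Matrix.fromBlocks 1 s 0 η with hγ₂
  have hγ₂u : IsUnit γ₂.det := by simpa [hγ₂] using hη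
  have hu : IsUnit (γ₁ * γ₂).det := by
    rw [Matrix.det_mul]
    exact hγ₁.mul hγ₂u
  have hreal : Matrix.fromBlocks 1 t 0 1 * realMat γ₂ = Matrix.fromBlocks 1 w 0 (realMat η) := by
    rw [hγ₂, realMat, Matrix.fromBlocks_map, Matrix.fromBlocks_multiply]
    simp [hw]
  have hQ : (realMat (γ₁ * γ₂))ᵀ * q * realMat (γ₁ * γ₂) =
      (Matrix.fromBlocks 1 w 0 (realMat η))ᵀ *
        Matrix.fromBlocks (Matrix.diagonal fun _ => d) 0 0 S *
          Matrix.fromBlocks 1 w 0 (realMat η) := by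
    rw [← hreal, realMat_mul, Matrix.transpose_mul, Matrix.transpose_mul]
    calc _ = (realMat γ₂)ᵀ * ((realMat γ₁)ᵀ * q * realMat γ₁) * realMat γ₂ := by
          simp only [Matrix.mul_assoc]
      _ = _ := by rw [hq₁]; simp only [Matrix.mul_assoc]
  have hdiag : (Matrix.diagonal fun _ : Unit => d) = d • (1 : Matrix Unit Unit ℝ) := by
    rw [Matrix.smul_one_eq_diagonal]
  have hQ' : (realMat (γ₁ * γ₂))ᵀ * q * realMat (γ₁ * γ₂) =
      Matrix.fromBlocks (d • 1) (d • w) (d • wᵀ)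
        (d • (wᵀ * w) + (realMat η)ᵀ * S * realMat η) := by
    rw [hQ, hdiag]
    simp [Matrix.fromBlocks_transpose, Matrix.fromBlocks_multiply]
  refine ⟨γ₁ * γ₂, hu, Matrix.fromBlocks 1 w 0 T, Sum.elim (fun _ => d) e, by simpa using hT,
    ?_, ?_, ?_, ?_⟩
  · rintro (i | i) (j | j)
    · simp
    · simpa using (hw1 i j).trans (by norm_num)
    · simp
    · exact hT1 i j
  · rintro (i | i)
    · exact hd
    · exact he i
  · rw [hQ', hST, ← Matrix.fromBlocks_diagonal, hdiag]
    simp [Matrix.fromBlocks_transpose, Matrix.fromBlocks_multiply]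
  · rintro (j | j)
    · refine ⟨Sum.inl (), ?_⟩
      rw [hQ']
      have : (1 : ℝ) ≤ 4 ^ Fintype.card (Unit ⊕ ι) := one_le_pow₀ (by norm_num)
      simpa using le_mul_of_one_le_left hd.le this
    · obtain ⟨i, hi⟩ := hle j
      refine ⟨Sum.inl (), ?_⟩
      -- Almost minimality gives `d < 2 (d/4 + 4^N e j)` with `N` the size of `ι`, hence `d <
      -- 4^(N+1) e j`: one factor of four per variable.
      have h1 := hmin _ hu (Sum.inr i)
      have h2 : ((realMat γ₁)ᵀ * q * realMat γ₁) (Sum.inl ()) (Sum.inl ()) = d := by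
        rw [hq₁, hdiag]
        simp [Matrix.fromBlocks_transpose, Matrix.fromBlocks_multiply]
      have h3 : (wᵀ * w) i i ≤ 1 / 4 := by
        have := abs_le.1 (hw1 () i)
        simp only [Matrix.mul_apply, Matrix.transpose_apply, Finset.univ_unique,
          Finset.sum_singleton]
        change w () i * w () i ≤ 1 / 4
        nlinarith
      rw [h2, hQ'] at h1
      simp only [Matrix.fromBlocks_apply₂₂, Matrix.add_apply, Matrix.smul_apply,
        smul_eq_mul] at h1
      have h4 := mul_le_mul_of_nonneg_left h3 hd.le
      rw [hQ']
      simp only [Matrix.fromBlocks_apply₁₁, Matrix.smul_apply, Matrix.one_apply_eq, smul_eq_mul,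
        mul_one, Sum.elim_inr, Fintype.card_sum, Fintype.card_unit, pow_add, pow_one]
      linarith

theorem reducible_fin : ∀ m : ℕ, Reducible (Fin m)
  | 0 => reducible_of_isEmpty
  | m + 1 => (reducible_fin m).unit_sum.of_equiv
      (((Equiv.sumComm _ _).trans (Equiv.sumCongr (Equiv.refl _) finOneEquiv.symm)).trans
        finSumFinEquiv)

/-- Every positive definite form is reduced in a suitable integral basis. -/
theorem reducible (ι : Type*) [Fintype ι] [DecidableEq ι] : Reducible ι :=
  (reducible_fin _).of_equiv (Fintype.equivFin ι).symm

/-- Mahler's compactness criterion for forms, with integral changes of basis made explicit. -/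
theorem exists_compact_of_minimum_of_det (ι : Type*) [Fintype ι] [DecidableEq ι] (c C : ℝ)
    (hc : 0 < c) :
    ∃ K : Set (Matrix ι ι ℝ), IsCompact K ∧ (∀ Q ∈ K, Q.PosDef) ∧
      ∀ q : Matrix ι ι ℝ, q.PosDef → q.det ≤ C →
        (∀ a : ι → ℤ, a ≠ 0 → c ≤ (fun i => (a i : ℝ)) ⬝ᵥ (q *ᵥ fun i => (a i : ℝ))) →
        ∃ γ : Matrix ι ι ℤ, IsUnit γ.det ∧ (realMat γ)ᵀ * q * realMat γ ∈ K := by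
  set N := Fintype.card ι with hN
  set l : ℝ := c / 4 ^ N with hl
  have hl0 : 0 < l := by positivity
  set R : ℝ := C / l ^ (N - 1) with hR
  set A : Set (Matrix ι ι ℝ × (ι → ℝ)) :=
    ((Set.univ.pi fun _ => Set.univ.pi fun _ => Set.Icc (-1) 1) ∩ {T : Matrix ι ι ℝ | T.det = 1}) ×ˢ
      (Set.univ.pi fun _ => Set.Icc l R) with hA
  have hAc : IsCompact A := by
    refine IsCompact.prod (IsCompact.inter_right ?_ ?_) (isCompact_univ_pi fun _ => isCompact_Icc)
    · exact isCompact_univ_pi fun _ => isCompact_univ_pi fun _ => isCompact_Icc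
    · exact isClosed_eq (by fun_prop) continuous_const
  refine ⟨(fun p => p.1ᵀ * Matrix.diagonal p.2 * p.1) '' A, hAc.image (by fun_prop), ?_, ?_⟩
  · rintro _ ⟨⟨T, d⟩, ⟨⟨-, hT⟩, hd⟩, rfl⟩
    refine posDef_congr (Matrix.PosDef.diagonal fun i => hl0.trans_le (hd i trivial).1) ?_
    have hT' : T.det = 1 := hT
    simp [hT']
  · intro q hq hdet hmin
    obtain ⟨γ, hγ, T, d, hT, hT1, hd, hQ, hle⟩ := reducible ι q hq
    refine ⟨γ, hγ, (T, d), ⟨⟨fun i _ j _ => abs_le.1 (hT1 i j), hT⟩, fun i _ => ?_⟩, hQ.symm⟩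
    have hlow : ∀ j, l ≤ d j := by
      intro j
      obtain ⟨i, hi⟩ := hle j
      rw [congr_apply_self] at hi
      rw [hl, div_le_iff₀ (by positivity), mul_comm]
      exact (hmin _ (column_ne_zero hγ i)).trans hi
    refine ⟨hlow i, ?_⟩
    have hdetQ : q.det = ∏ j, d j := by
      have h1 := congrArg Matrix.det hQ
      simp only [Matrix.det_mul, Matrix.det_transpose, hT, Matrix.det_diagonal, det_realMat,
        one_mul, mul_one] at h1
      rw [← h1, mul_right_comm]
      rcases Int.isUnit_iff.1 hγ with h | h <;> simp [h]
    -- The product of all `d j` is at most `C`, and the other `N - 1` factors are each at least `l`.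
    rw [hR, le_div_iff₀ (by positivity)]
    refine le_trans ?_ hdet
    rw [hdetQ, ← Finset.mul_prod_erase _ _ (Finset.mem_univ i)]
    refine mul_le_mul_of_nonneg_left ?_ (hd i).le
    have h2 := Finset.prod_le_prod (s := Finset.univ.erase i) (f := fun _ => l) (g := d)
      (fun _ _ => hl0.le) (fun j _ => hlow j)
    simpa [Finset.card_erase_of_mem, hN] using h2

end Reduction

end Heisenberg

namespace Heisenberg

/-! ### From eigenvalues of `Y⁻¹J` to a bound of `J` by `Y` -/

section Spectral

open scoped ComplexOrder MatrixOrder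

variable {ι : Type*} [Fintype ι]

theorem star_dotProduct_map_mulVec (X : Matrix ι ι ℝ) (u v : ι → ℝ) :
    star ((fun i => (u i : ℂ)) + Complex.I • fun i => (v i : ℂ)) ⬝ᵥ
      (X.map ((↑) : ℝ → ℂ) *ᵥ ((fun i => (u i : ℂ)) + Complex.I • fun i => (v i : ℂ))) =
    ((u ⬝ᵥ (X *ᵥ u) + v ⬝ᵥ (X *ᵥ v) : ℝ) : ℂ) +
      Complex.I * ((u ⬝ᵥ (X *ᵥ v) - v ⬝ᵥ (X *ᵥ u) : ℝ) : ℂ) := by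
  have hmul : ∀ w : ι → ℝ, X.map ((↑) : ℝ → ℂ) *ᵥ (fun i => (w i : ℂ)) =
      fun i => ((X *ᵥ w) i : ℂ) := fun w => by
    ext i
    simp [Matrix.mulVec, dotProduct]
  have hdot : ∀ w z : ι → ℝ, (fun i => (w i : ℂ)) ⬝ᵥ (fun i => (z i : ℂ)) = ((w ⬝ᵥ z : ℝ) : ℂ) :=
    fun w z => by simp [dotProduct]
  have hstar : ∀ w : ι → ℝ, star (fun i => (w i : ℂ)) = fun i => (w i : ℂ) := fun w => by
    ext i
    simp
  simp only [star_add, star_smul, hstar, Matrix.mulVec_add, Matrix.mulVec_smul, hmul,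
    add_dotProduct, dotProduct_add, smul_dotProduct, dotProduct_smul, hdot, smul_eq_mul,
    Complex.star_def, Complex.conj_I]
  push_cast
  linear_combination (-((v ⬝ᵥ (X *ᵥ v) : ℝ) : ℂ)) * Complex.I_mul_I

variable [DecidableEq ι]

theorem exists_sqrt_of_posDef {Y : Matrix ι ι ℝ} (hY : Y.PosDef) :
    ∃ B : Matrix ι ι ℝ, IsUnit B.det ∧ Y = Bᵀ * B := by
  obtain ⟨B, hB⟩ := CStarAlgebra.nonneg_iff_eq_star_mul_self.mp hY.posSemidef.nonneg
  rw [Matrix.star_eq_conjTranspose, Matrix.conjTranspose_eq_transpose_of_trivial] at hB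
  refine ⟨B, ?_, hB⟩
  have h1 := (Matrix.isUnit_iff_isUnit_det _).1 hY.isUnit
  rw [hB, Matrix.det_mul] at h1
  exact isUnit_of_mul_isUnit_right h1

/-- If the eigenvalues `i d` of `Y⁻¹ J` satisfy `d ≤ C`, then `J` is bounded by `C Y`. -/
theorem two_mul_dotProduct_le_of_eigenvalue_le {Y J : Matrix ι ι ℝ} (hY : Y.PosDef)
    (hJ : Jᵀ = -J) {C : ℝ} (hC : 0 ≤ C)
    (hle : ∀ d : ℝ, 0 < d → Module.End.HasEigenvalue
      (Matrix.toLin' ((Y⁻¹ * J).map ((↑) : ℝ → ℂ))) (Complex.I * (d : ℂ)) → d ≤ C)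
    (u v : ι → ℝ) :
    2 * (u ⬝ᵥ (J *ᵥ v)) ≤ C * (u ⬝ᵥ (Y *ᵥ u) + v ⬝ᵥ (Y *ᵥ v)) := by
  obtain ⟨B, hB, hYB⟩ := exists_sqrt_of_posDef hY
  set P := B⁻¹ with hP
  have hPB : P * B = 1 := Matrix.nonsing_inv_mul _ hB
  have hBP : B * P = 1 := Matrix.mul_nonsing_inv _ hB
  have hBPt : Bᵀ * Pᵀ = 1 := by rw [← Matrix.transpose_mul, hPB, Matrix.transpose_one]
  have hYinv : Y⁻¹ = P * Pᵀ := by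
    rw [hYB, Matrix.mul_inv_rev, hP, Matrix.transpose_nonsing_inv]
  set c : Matrix ι ι ℝ →+* Matrix ι ι ℂ := (Complex.ofRealHom).mapMatrix with hc
  have hcH : ∀ X : Matrix ι ι ℝ, (c X)ᴴ = c Xᵀ := fun X => by
    ext i j
    simp [hc, Matrix.conjTranspose_apply]
  set S := Pᵀ * J * P with hS
  have hSt : Sᵀ = -S := by
    simp [hS, Matrix.transpose_mul, hJ, Matrix.mul_assoc]
  -- With `Y = BᵀB`, the matrix `Y⁻¹J` is similar to the skew matrix `S`, so `N` is Hermitian. An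
  -- eigenvalue `μ < 0` of `N` would give the eigenvalue `i(C - μ)` of `Y⁻¹J`, with `C - μ > C`.
  set N : Matrix ι ι ℂ := Complex.I • c S + (C : ℂ) • 1 with hN
  have hNH : N.IsHermitian := by
    rw [Matrix.IsHermitian, hN, Matrix.conjTranspose_add, Matrix.conjTranspose_smul, hcH, hSt]
    simp
  have hpsd : N.PosSemidef := by
    rw [hNH.posSemidef_iff_eigenvalues_nonneg]
    intro i
    by_contra hneg
    have hμ : hNH.eigenvalues i < 0 := not_le.1 hneg
    set μ := hNH.eigenvalues i with hμdef
    set x : ι → ℂ := ⇑(hNH.eigenvectorBasis i) with hx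
    have hNx : N *ᵥ x = (μ : ℂ) • x := by
      rw [hx, hNH.mulVec_eigenvectorBasis i]
      rfl
    have hx0 : x ≠ 0 := by
      intro h0
      exact hNH.eigenvectorBasis.orthonormal.ne_zero i (by ext j; exact congrFun h0 j)
    have hSx : c S *ᵥ x = (Complex.I * ((C - μ : ℝ) : ℂ)) • x := by
      rw [hN, Matrix.add_mulVec, Matrix.smul_mulVec, Matrix.smul_mulVec, Matrix.one_mulVec] at hNx
      ext j
      have h1 := congrFun hNx j
      simp only [Pi.add_apply, Pi.smul_apply, smul_eq_mul] at h1 ⊢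
      push_cast
      linear_combination (-Complex.I) * h1 + (c S *ᵥ x) j * Complex.I_mul_I
    have hcPx : c P *ᵥ x ≠ 0 := by
      intro h0
      apply hx0
      have : c B *ᵥ (c P *ᵥ x) = x := by
        rw [Matrix.mulVec_mulVec, ← map_mul, hBP, map_one, Matrix.one_mulVec]
      rw [← this, h0, Matrix.mulVec_zero]
    have hev : Module.End.HasEigenvalue
        (Matrix.toLin' ((Y⁻¹ * J).map ((↑) : ℝ → ℂ))) (Complex.I * ((C - μ : ℝ) : ℂ)) := by
      refine Module.End.hasEigenvalue_of_hasEigenvector (x := c P *ᵥ x)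
        (Module.End.hasEigenvector_iff.2 ⟨Module.End.mem_eigenspace_iff.2 ?_, hcPx⟩)
      rw [Matrix.toLin'_apply]
      change c (Y⁻¹ * J) *ᵥ (c P *ᵥ x) = _
      rw [Matrix.mulVec_mulVec, ← map_mul, hYinv, ← Matrix.mulVec_smul, ← hSx,
        Matrix.mulVec_mulVec, ← map_mul, hS]
      simp only [Matrix.mul_assoc]
    have := hle _ (by linarith) hev
    linarith
  have hform : (c B)ᴴ * N * c B = Complex.I • c J + (C : ℂ) • c Y := by
    have h1 : Bᵀ * S * B = J := by
      calc Bᵀ * S * B = (Bᵀ * Pᵀ) * J * (P * B) := by simp only [hS, Matrix.mul_assoc]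
        _ = J := by rw [hBPt, hPB, Matrix.one_mul, Matrix.mul_one]
    rw [hcH, hN, Matrix.mul_add, Matrix.add_mul, Matrix.mul_smul, Matrix.smul_mul, Matrix.mul_smul,
      Matrix.smul_mul, Matrix.mul_one, ← map_mul, ← map_mul, ← map_mul, h1, ← hYB]
  have hpsd' := hpsd.conjTranspose_mul_mul_same (c B)
  rw [hform] at hpsd'
  have h2 := hpsd'.re_dotProduct_nonneg ((fun i => (u i : ℂ)) + Complex.I • fun i => (v i : ℂ))
  have h3 : v ⬝ᵥ (J *ᵥ u) = -(u ⬝ᵥ (J *ᵥ v)) := by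
    rw [Matrix.dotProduct_mulVec, ← Matrix.mulVec_transpose, hJ, Matrix.neg_mulVec, neg_dotProduct,
      dotProduct_comm]
  have e1 := star_dotProduct_map_mulVec J u v
  have e2 := star_dotProduct_map_mulVec Y u v
  change star _ ⬝ᵥ (c J *ᵥ _) = _ at e1
  change star _ ⬝ᵥ (c Y *ᵥ _) = _ at e2
  rw [Matrix.add_mulVec, Matrix.smul_mulVec, Matrix.smul_mulVec, dotProduct_add, dotProduct_smul,
    dotProduct_smul, e1, e2, h3] at h2
  simp only [smul_eq_mul, RCLike.re_to_complex, Complex.add_re, Complex.mul_re, Complex.I_re,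
    Complex.I_im, Complex.ofReal_re, Complex.ofReal_im, Complex.add_im, Complex.mul_im] at h2
  linarith

end Spectral

theorem symplJ_transpose (n : ℕ) : (symplJ n)ᵀ = -symplJ n := by
  simp [symplJ, Matrix.fromBlocks_transpose, Matrix.fromBlocks_neg]

/-- Needed so that the real `sSup` in `dMax` bounds every element rather than taking its default
value. -/
theorem dSet_bddAbove {n : ℕ} (Y : PosMat n) : BddAbove (dSet Y) := by
  refine (Set.Finite.subset (((Module.End.finite_hasEigenvalue (Matrix.toLin'
    (((Y : Matrix (Idx n) (Idx n) ℝ)⁻¹ * symplJ n).map ((↑) : ℝ → ℂ)))).preimage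
      (f := fun d : ℝ => Complex.I * (d : ℂ)) ?_)) fun d hd => hd.2).bddAbove
  intro x _ y _ hxy
  simpa using hxy

theorem two_mul_dotProduct_le_of_dMax_le {n : ℕ} (Y : PosMat n) {C : ℝ} (hC : 0 ≤ C)
    (hle : dMax Y ≤ C) (u v : Idx n → ℝ) :
    2 * (u ⬝ᵥ (symplJ n *ᵥ v)) ≤ C * (u ⬝ᵥ (Y.1 *ᵥ u) + v ⬝ᵥ (Y.1 *ᵥ v)) :=
  two_mul_dotProduct_le_of_eigenvalue_le Y.2 (symplJ_transpose n) hC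
    (fun _ hd hev => (le_csSup (dSet_bddAbove Y) ⟨hd, hev⟩).trans hle) u v

end Heisenberg

/-! ### The action of `Π_r` on controlled metrics -/

namespace Heisenberg

variable {n : ℕ}

theorem dotProduct_congr_mulVec {ι κ : Type*} [Fintype ι] [Fintype κ] (q : Matrix ι ι ℝ)
    (g : Matrix ι κ ℝ) (u v : κ → ℝ) :
    u ⬝ᵥ ((gᵀ * q * g) *ᵥ v) = (g *ᵥ u) ⬝ᵥ (q *ᵥ (g *ᵥ v)) := by
  rw [Matrix.mul_assoc, ← Matrix.mulVec_mulVec, ← Matrix.mulVec_mulVec, Matrix.dotProduct_mulVec,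
    Matrix.vecMul_transpose]

theorem delta_val (r : DivChain n) : (delta r : Matrix (Idx n) (Idx n) ℝ) = deltaMat r := rfl

theorem mem_latticeGroup_mul {r : DivChain n} {β : GL (Idx n) ℝ} (hβ : β ∈ latticeGroup r) :
    ∃ γ : Matrix (Idx n) (Idx n) ℤ, IsUnit γ.det ∧
      (β : Matrix (Idx n) (Idx n) ℝ) * deltaMat r = deltaMat r * realMat γ := by
  obtain ⟨_, ⟨γ, rfl⟩, rfl⟩ := hβ
  refine ⟨γ, (Matrix.isUnit_iff_isUnit_det _).1 γ.isUnit, ?_⟩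
  have h : MulAut.conj (delta r) (Matrix.GeneralLinearGroup.map (Int.castRingHom ℝ) γ) * delta r =
      delta r * Matrix.GeneralLinearGroup.map (Int.castRingHom ℝ) γ := by
    simp [MulAut.conj_apply]
  exact congrArg Units.val h

theorem conj_mem_latticeGroup (r : DivChain n) (γ : GL (Idx n) ℤ) :
    delta r * Matrix.GeneralLinearGroup.map (Int.castRingHom ℝ) γ * (delta r)⁻¹ ∈
      latticeGroup r :=
  ⟨_, ⟨γ, rfl⟩, rfl⟩

/-- The conditions on a metric that cut out a compact part of the moduli space, in a form which
is visibly closed. -/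
def Controlled (r : DivChain n) (C₀ C₁ C₂ : ℝ) (h : Matrix (Idx n) (Idx n) ℝ) : Prop :=
  (∀ a : Idx n → ℤ, a ≠ 0 → C₀ ≤ (deltaMat r *ᵥ fun i => (a i : ℝ)) ⬝ᵥ
      (h *ᵥ (deltaMat r *ᵥ fun i => (a i : ℝ)))) ∧
    h.det ≤ C₁ ∧
    ∀ u v : Idx n → ℝ, 2 * (u ⬝ᵥ (symplJ n *ᵥ v)) ≤ C₂ * (u ⬝ᵥ (h *ᵥ u) + v ⬝ᵥ (h *ᵥ v))

theorem controlled_of_bounds (r : DivChain n) (Y : PosMat n) {C₀ C₁ C₂ : ℝ} (hC₂ : 0 ≤ C₂)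
    (h₀ : C₀ ≤ firstMin r Y) (h₁ : Y.1.det ≤ C₁) (h₂ : dMax Y ≤ C₂) :
    Controlled r C₀ C₁ C₂ Y.1 := by
  refine ⟨fun a ha => h₀.trans (csInf_le ⟨0, ?_⟩ ⟨a, ha, rfl⟩), h₁,
    two_mul_dotProduct_le_of_dMax_le Y hC₂ h₂⟩
  rintro _ ⟨c, -, rfl⟩
  simpa using Y.2.posSemidef.dotProduct_mulVec_nonneg (deltaMat r *ᵥ fun i => (c i : ℝ))

theorem isClosed_controlled (r : DivChain n) (C₀ C₁ C₂ : ℝ) :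
    IsClosed {h | Controlled r C₀ C₁ C₂ h} := by
  simp only [Controlled, Set.ofPred_and, Set.ofPred_forall]
  refine (isClosed_iInter fun a => isClosed_iInter fun _ => ?_).inter (IsClosed.inter ?_
    (isClosed_iInter fun u => isClosed_iInter fun v => ?_))
  all_goals exact isClosed_le (by fun_prop) (by fun_prop)

theorem Controlled.congr {r : DivChain n} {C₀ C₁ C₂ : ℝ} {h : Matrix (Idx n) (Idx n) ℝ}
    (hh : Controlled r C₀ C₁ C₂ h) {β : GL (Idx n) ℝ} (hβ : β ∈ piGroup r) :
    Controlled r C₀ C₁ C₂ ((β : Matrix (Idx n) (Idx n) ℝ)ᵀ * h * β) := by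
  obtain ⟨h₀, h₁, h₂⟩ := hh
  obtain ⟨γ, hγ, hβγ⟩ := mem_latticeGroup_mul hβ.1
  refine ⟨fun a ha => ?_, ?_, fun u v => ?_⟩
  · have hγa : γ *ᵥ a ≠ 0 := fun h0 => ha <|
      (Matrix.mulVec_injective_of_isUnit ((Matrix.isUnit_iff_isUnit_det _).2 hγ))
        (h0.trans (Matrix.mulVec_zero γ).symm)
    have hcast : (fun i => ((γ *ᵥ a) i : ℝ)) = realMat γ *ᵥ fun i => (a i : ℝ) := by
      ext i
      simp [Matrix.mulVec, dotProduct]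
    have := h₀ _ hγa
    rwa [hcast, Matrix.mulVec_mulVec, ← hβγ, ← Matrix.mulVec_mulVec,
      ← dotProduct_congr_mulVec] at this
  · have hdet : (β : Matrix (Idx n) (Idx n) ℝ).det = γ.det := by
      have := congrArg Matrix.det hβγ
      rw [Matrix.det_mul, Matrix.det_mul, mul_comm, det_realMat] at this
      exact mul_left_cancel₀ (deltaMat_det_ne_zero r) this
    rw [Matrix.det_mul, Matrix.det_mul, Matrix.det_transpose, hdet]
    rcases Int.isUnit_iff.1 hγ with h | h <;> simpa [h] using h₁
  · rw [dotProduct_congr_mulVec, dotProduct_congr_mulVec]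
    have hJ : ∀ w z : Idx n → ℝ, ((β : Matrix (Idx n) (Idx n) ℝ) *ᵥ w) ⬝ᵥ
        (symplJ n *ᵥ ((β : Matrix (Idx n) (Idx n) ℝ) *ᵥ z)) = w ⬝ᵥ (symplJ n *ᵥ z) ∨
        ((β : Matrix (Idx n) (Idx n) ℝ) *ᵥ w) ⬝ᵥ
        (symplJ n *ᵥ ((β : Matrix (Idx n) (Idx n) ℝ) *ᵥ z)) = -(w ⬝ᵥ (symplJ n *ᵥ z)) := by
      intro w z
      rw [← dotProduct_congr_mulVec]
      rcases hβ.2 with h | h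
      · left; rw [h]
      · right; rw [h, Matrix.neg_mulVec, dotProduct_neg]
    rcases hJ u v with h | h
    · rw [← h]
      exact h₂ _ _
    -- In the antisymplectic case, replacing `v` by `-v` absorbs the sign and leaves the quadratic
    -- terms unchanged.
    · have := h₂ ((β : Matrix (Idx n) (Idx n) ℝ) *ᵥ u) (-((β : Matrix (Idx n) (Idx n) ℝ) *ᵥ v))
      simp only [Matrix.mulVec_neg, dotProduct_neg, neg_dotProduct, neg_neg] at this
      rwa [h, neg_neg] at this

/-- Integrality of the symplectic form on the lattice `δℤ²ⁿ` is what turns boundedness into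
finiteness. -/
theorem exists_realMat_eq_delta_symplJ_delta (r : DivChain n) :
    ∃ Z : Matrix (Idx n) (Idx n) ℤ,
      realMat Z = (deltaMat r)ᵀ * symplJ n * deltaMat r := by
  refine ⟨Matrix.diagonal (Sum.elim (fun i => (r.toFun i : ℤ)) fun _ => 1) *
    Matrix.fromBlocks 0 1 (-1) 0 *
    Matrix.diagonal (Sum.elim (fun i => (r.toFun i : ℤ)) fun _ => 1), ?_⟩
  have hδ : realMat (Matrix.diagonal (Sum.elim (fun i => (r.toFun i : ℤ)) fun _ : Fin n => 1)) =
      deltaMat r := by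
    rw [realMat, Matrix.diagonal_map Int.cast_zero, deltaMat]
    congr 1
    ext (i | i) <;> simp
  have hJ : realMat (Matrix.fromBlocks 0 1 (-1) 0 : Matrix (Idx n) (Idx n) ℤ) = symplJ n := by
    ext (i | i) (j | j) <;> simp [symplJ, Matrix.one_apply, apply_ite]
  rw [realMat_mul, realMat_mul, hδ, hJ]
  simp [deltaMat]

theorem finite_intMatrix_bounded {ι : Type*} [Fintype ι] (c : ℝ) :
    {B : Matrix ι ι ℤ | ∀ i j, |(B i j : ℝ)| ≤ c}.Finite := by
  have h : {x : ℤ | |(x : ℝ)| ≤ c}.Finite := by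
    refine (Set.finite_Icc (-⌈c⌉) ⌈c⌉).subset fun x hx => ?_
    obtain ⟨h1, h2⟩ := abs_le.1 (show |(x : ℝ)| ≤ c from hx)
    have h3 := Int.le_ceil c
    constructor
    · have : ((-⌈c⌉ : ℤ) : ℝ) ≤ x := by push_cast; linarith
      exact_mod_cast this
    · have : (x : ℝ) ≤ ⌈c⌉ := by linarith
      exact_mod_cast this
  exact Set.Finite.pi' fun _ => Set.Finite.pi' fun _ => h

/-- Controlled metrics can be moved into a fixed compact set by `Π_r`: a lattice reduction leaves
only finitely many possibilities for the transformed symplectic form. -/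
theorem exists_compact_fundamental (r : DivChain n) {C₀ C₁ C₂ : ℝ} (hC₀ : 0 < C₀) (hC₂ : 0 ≤ C₂) :
    ∃ K : Set (Matrix (Idx n) (Idx n) ℝ), IsCompact K ∧ (∀ Q ∈ K, Q.PosDef) ∧
      ∀ h : Matrix (Idx n) (Idx n) ℝ, h.PosDef → Controlled r C₀ C₁ C₂ h →
        ∃ β ∈ piGroup r, (β : Matrix (Idx n) (Idx n) ℝ)ᵀ * h * β ∈ K := by
  set δ := deltaMat r with hδ
  have hδu : IsUnit δ.det := (deltaMat_det_ne_zero r).isUnit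
  obtain ⟨K, hK, hKpos, hred⟩ :=
    exists_compact_of_minimum_of_det (Idx n) C₀ (δ.det ^ 2 * C₁) hC₀
  obtain ⟨R, hR⟩ := hK.exists_bound_of_continuousOn
    (f := fun Q : Matrix (Idx n) (Idx n) ℝ => fun i => Q i i)
    (Continuous.continuousOn (by fun_prop))
  obtain ⟨Z, hZ⟩ := exists_realMat_eq_delta_symplJ_delta r
  -- One representative per integral form, depending on `B` alone; the default `1` serves forms not
  -- equivalent to `Z`.
  have hchoice : ∀ B : Matrix (Idx n) (Idx n) ℤ, ∃ η : Matrix (Idx n) (Idx n) ℤ, IsUnit η.det ∧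
      ((∃ γ : Matrix (Idx n) (Idx n) ℤ, IsUnit γ.det ∧ γᵀ * Z * γ = B) → ηᵀ * Z * η = B) := by
    intro B
    by_cases h : ∃ γ : Matrix (Idx n) (Idx n) ℤ, IsUnit γ.det ∧ γᵀ * Z * γ = B
    · obtain ⟨γ, hγ, hB⟩ := h
      exact ⟨γ, hγ, fun _ => hB⟩
    · exact ⟨1, by simp, fun h' => (h h').elim⟩
  choose η hη hηB using hchoice
  set g : Matrix (Idx n) (Idx n) ℤ → Matrix (Idx n) (Idx n) ℝ :=
    fun B => (realMat (η B))⁻¹ * δ⁻¹ with hg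
  have hgu : ∀ B, IsUnit (g B).det := fun B => by
    rw [hg, Matrix.det_mul]
    exact (Matrix.isUnit_nonsing_inv_det _ (isUnit_det_realMat (hη B))).mul
      (Matrix.isUnit_nonsing_inv_det _ hδu)
  refine ⟨⋃ B ∈ {B : Matrix (Idx n) (Idx n) ℤ | ∀ i j, |(B i j : ℝ)| ≤ C₂ * R},
    (fun Q => (g B)ᵀ * Q * g B) '' K, ?_, ?_, ?_⟩
  · exact (finite_intMatrix_bounded _).isCompact_biUnion fun B _ => hK.image (by fun_prop)
  · intro Q hQ
    simp only [Set.mem_iUnion] at hQ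
    obtain ⟨B, -, Q', hQ', rfl⟩ := hQ
    exact posDef_congr (hKpos _ hQ') (hgu B)
  rintro h hpos ⟨h₀, h₁, h₂⟩
  obtain ⟨γ, hγ, hγK⟩ := hred (δᵀ * h * δ) (posDef_congr hpos hδu) (by
      rw [Matrix.det_mul, Matrix.det_mul, Matrix.det_transpose, mul_right_comm, ← pow_two]
      exact mul_le_mul_of_nonneg_left h₁ (sq_nonneg _))
    (fun a ha => by
      rw [dotProduct_congr_mulVec]
      exact h₀ a ha)
  set G := δ * realMat γ with hG
  have hGh : (realMat γ)ᵀ * (δᵀ * h * δ) * realMat γ = Gᵀ * h * G := by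
    rw [hG, Matrix.transpose_mul]
    simp only [Matrix.mul_assoc]
  rw [hGh] at hγK
  set B := γᵀ * Z * γ with hB
  have hcastB : ∀ θ : Matrix (Idx n) (Idx n) ℤ, realMat (θᵀ * Z * θ) =
      (δ * realMat θ)ᵀ * symplJ n * (δ * realMat θ) := fun θ => by
    rw [realMat_mul, realMat_mul, hZ, Matrix.transpose_mul]
    simp only [Matrix.mul_assoc]
    rfl
  have hηB' : (η B)ᵀ * Z * η B = B := hηB B ⟨γ, hγ, rfl⟩
  -- Apply the domination of `J` to columns `i` and `±j` of `G`, whose `h`-values are diagonal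
  -- entries of `GᵀhG`, at most `R`.
  have hBmem : ∀ i j, |(B i j : ℝ)| ≤ C₂ * R := by
    intro i j
    have hentry : (B i j : ℝ) = (fun k => G k i) ⬝ᵥ (symplJ n *ᵥ fun k => G k j) := by
      have h1 := dotProduct_congr_mulVec (symplJ n) G (Pi.single i 1) (Pi.single j 1)
      rw [hG, ← hcastB, ← hG] at h1
      simp only [Matrix.mulVec_single_one, single_one_dotProduct] at h1
      exact h1
    have hdiag : ∀ k, (Gᵀ * h * G) k k ≤ R := fun k =>
      (le_abs_self _).trans ((norm_le_pi_norm (fun i => (Gᵀ * h * G) i i) k).trans (hR _ hγK))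
    have hi := hdiag i
    have hj := hdiag j
    rw [congr_apply_self] at hi hj
    have hb := mul_le_mul_of_nonneg_left (add_le_add hi hj) hC₂
    have hp := h₂ (fun k => G k i) (fun k => G k j)
    have hm := h₂ (fun k => G k i) (-fun k => G k j)
    simp only [Matrix.mulVec_neg, dotProduct_neg, neg_dotProduct, neg_neg] at hm
    rw [hentry, abs_le]
    constructor <;> linarith
  set γu : GL (Idx n) ℤ := Matrix.GeneralLinearGroup.mk'' γ hγ
  set ηu : GL (Idx n) ℤ := Matrix.GeneralLinearGroup.mk'' (η B) (hη B)
  set β : GL (Idx n) ℝ := delta r *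
    Matrix.GeneralLinearGroup.map (Int.castRingHom ℝ) (γu * ηu⁻¹) * (delta r)⁻¹ with hβ
  have hβval : (β : Matrix (Idx n) (Idx n) ℝ) = G * g B := by
    rw [hβ, map_mul, map_inv, Units.val_mul, Units.val_mul, Units.val_mul, Matrix.coe_units_inv,
      Matrix.coe_units_inv, delta_val, hG, hg]
    simp only [Matrix.mul_assoc]
    rfl
  have hcongr : ∀ X : Matrix (Idx n) (Idx n) ℝ,
      (β : Matrix (Idx n) (Idx n) ℝ)ᵀ * X * β = (g B)ᵀ * (Gᵀ * X * G) * g B := fun X => by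
    rw [hβval, Matrix.transpose_mul]
    simp only [Matrix.mul_assoc]
  refine ⟨β, ⟨conj_mem_latticeGroup r _, Or.inl ?_⟩, ?_⟩
  · have hone : δ * realMat (η B) * g B = 1 := by
      rw [hg, Matrix.mul_assoc, ← Matrix.mul_assoc (realMat (η B)),
        Matrix.mul_nonsing_inv _ (isUnit_det_realMat (hη B)), Matrix.one_mul,
        Matrix.mul_nonsing_inv _ hδu]
    have hform : Gᵀ * symplJ n * G =
        (δ * realMat (η B))ᵀ * symplJ n * (δ * realMat (η B)) := by
      rw [hG, ← hcastB, ← hcastB, hηB']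
    calc (β : Matrix (Idx n) (Idx n) ℝ)ᵀ * symplJ n * β
        = (δ * realMat (η B) * g B)ᵀ * symplJ n * (δ * realMat (η B) * g B) := by
          rw [hcongr, hform, Matrix.transpose_mul (δ * realMat (η B))]
          simp only [Matrix.mul_assoc]
      _ = symplJ n := by rw [hone]; simp
  · rw [hcongr]
    exact Set.mem_biUnion hBmem ⟨_, hγK, rfl⟩

end Heisenberg

/-! ### Compactness in the quotient -/

theorem corollary3p14 (n : ℕ) (hn : 1 ≤ n) (r : Heisenberg.DivChain n)
    (M : Set (Heisenberg.Moduli r)) (C₀ C₁ C₂ a b : ℝ)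
    (hC₀ : 0 < C₀) (hC₁ : 0 < C₁) (hC₂ : 0 < C₂) (ha : 0 < a)
    (hM : ∀ (h : Heisenberg.PosMat n) (g : Set.Ioi (0 : ℝ)), Heisenberg.Moduli.mk r h g ∈ M →
      (g : ℝ) ∈ Set.Icc a b ∧ C₀ ≤ Heisenberg.firstMin r h ∧
        (h : Matrix (Heisenberg.Idx n) (Heisenberg.Idx n) ℝ).det ≤ C₁ ∧
        Heisenberg.dMax h ≤ C₂) :
    IsCompact (closure M) := by
  let π : Heisenberg.PosMat n × Set.Ioi (0 : ℝ) → Heisenberg.Moduli r := Quotient.mk _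
  have hπ : Topology.IsQuotientMap π := isQuotientMap_quot_mk
  obtain ⟨K, hK, hKpos, hmove⟩ :=
    Heisenberg.exists_compact_fundamental r (C₁ := C₁) hC₀ hC₂.le
  let F : Set (Heisenberg.PosMat n × Set.Ioi (0 : ℝ)) :=
    {p | Heisenberg.Controlled r C₀ C₁ C₂ p.1.1 ∧ (p.2 : ℝ) ∈ Set.Icc a b}
  have hF : IsClosed F :=
    ((Heisenberg.isClosed_controlled r C₀ C₁ C₂).preimage
      (continuous_subtype_val.comp continuous_fst)).inter
        (isClosed_Icc.preimage (continuous_subtype_val.comp continuous_snd))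
  -- Saturation of `F`, from the invariance of `Controlled`, makes its image closed in the quotient
  -- topology.
  have hFpre : π ⁻¹' (π '' F) = F := by
    refine Set.Subset.antisymm ?_ (Set.subset_preimage_image π F)
    rintro q ⟨p, hp, hpq⟩
    obtain ⟨β, hβ, h1, h2⟩ := Quotient.exact hpq
    refine ⟨?_, h2 ▸ hp.2⟩
    rw [h1]
    exact hp.1.congr hβ
  have hclosed : IsClosed (π '' F) := by
    rw [← hπ.isClosed_preimage, hFpre]
    exact hF
  have hMF : M ⊆ π '' F := by
    intro m hm
    induction m using Quotient.inductionOn with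
    | h p =>
      obtain ⟨h₁, h₂, h₃, h₄⟩ := hM p.1 p.2 hm
      exact ⟨p, ⟨Heisenberg.controlled_of_bounds r p.1 hC₂.le h₂ h₃ h₄, h₁⟩, rfl⟩
  have hKc : IsCompact ((Subtype.val ⁻¹' K : Set (Heisenberg.PosMat n)) ×ˢ
      (Subtype.val ⁻¹' Set.Icc a b : Set (Set.Ioi (0 : ℝ)))) := by
    refine IsCompact.prod ?_ ?_
    · rw [Topology.IsEmbedding.subtypeVal.isCompact_iff,
        Set.image_preimage_eq_of_subset fun Q hQ => ⟨⟨Q, hKpos Q hQ⟩, rfl⟩]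
      exact hK
    · rw [Topology.IsEmbedding.subtypeVal.isCompact_iff,
        Set.image_preimage_eq_of_subset fun x hx => ⟨⟨x, ha.trans_le hx.1⟩, rfl⟩]
      exact isCompact_Icc
  refine (hKc.image hπ.continuous).of_isClosed_subset isClosed_closure
    ((closure_minimal hMF hclosed).trans ?_)
  rintro _ ⟨p, hp, rfl⟩
  obtain ⟨β, hβ, hβK⟩ := hmove p.1.1 p.1.2 hp.1
  exact ⟨(⟨_, hKpos _ hβK⟩, p.2), ⟨hβK, hp.2⟩,
    Quotient.sound ((Heisenberg.moduliSetoid r).symm ⟨β, hβ, rfl, rfl⟩)⟩
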